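/- **Queries.** Fix a non-empty domain $V$ of values with scalar functions, predicates (equality is always available) and aggregate functions, and a database schema. A table is a finite bag of rows over $V\cup\{\mathrm{NULL}\}$. SQL queries are built from table names by: cross products (the comma in $\mathtt{FROM}$); $\mathtt{SELECT}\ \vec e\ \mathtt{FROM}\ \vec R\ \mathtt{WHERE}\ \varphi$; aggregate queries $\mathtt{SELECT}\ \vec e,\vec\gamma\ \mathtt{FROM}\ \vec R\ \mathtt{WHERE}\ \varphi\ \mathtt{GROUP\ BY}\ \vec v$; $\mathtt{UNION\ ALL}$, $\mathtt{INTERSECT\ ALL}$, $\mathtt{EXCEPT\ ALL}$ and $\mathtt{DISTINCT}$. The members of $\vec R$ are tables or subqueries. Expressions are built from attributes, constants, the literal $\mathrm{NULL}$ and functions; in an aggregate query each $e_i$ uses only attributes of $\vec v$, and each $\gamma_i$ is an aggregate function applied to an expression. Formulas are built from predicates on expressions and $\mathtt{IS\ NULL}$ with $\mathtt{AND},\mathtt{OR},\mathtt{NOT}$. **Standard semantics** (of bags). A function or aggregate with a null input returns $\mathrm{NULL}$; a predicate with a null argument is $\mathrm{UNKNOWN}$; $\mathtt{IS\ NULL}$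 is two-valued; connectives follow Kleene's three-valued logic; $\mathtt{WHERE}$ keeps the rows for which $\varphi$ is true. Nulls are identified by $\mathtt{GROUP\ BY}$, $\mathtt{DISTINCT}$, $\mathtt{INTERSECT}$ and $\mathtt{EXCEPT}$. An aggregate query without $\mathtt{GROUP\ BY}$ has exactly one, possibly empty, group; the value of an aggregate on the empty bag is a constant or $\mathrm{NULL}$. **Column Normal Form.** A table $R$ with $k$ columns is replaced by $k+1$ null-free relations, using opaque row numbers as keys: $R_{\mathrm{id}}$, the set of all keys, and for each column $a$ the relation $R_a$ of all pairs (key, value) for the rows whose entry in column $a$ is not null. The *full outer join* of such a group of relations has one row for each key in $R_{\mathrm{id}}$, with $\mathrm{NULL}$ for each absent entry; the keys are dropped. **Columnar Semantics.** The syntax is that of SQL, with one additional atomic formula $R\ \mathtt{MISSING}\ a$: the current key of $R$ has no entry in $R_a$. The result of a query on a database in Column Normal Form is again a relation in Column Normal Form. A query with select list $c_1,\dots,c_k$ yields one relation of keys and one column for each $c_i$. A key (a combination of keys of the members of $\vec R$) is selected for the relation of keys if every attribute that occurs in $\varphi$ (other than as the argument of $\mathtt{MISSING}$), and every attribute of $\vec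 v$, has an entry at that key, and $\varphi$ is true of these entries. For the column of $c_i$, the attributes of $c_i$ must have entries as well. The column of an expression $c_i$ maps each such key to the value of $c_i$, and has no entry if that is $\mathrm{NULL}$. With $\mathtt{GROUP\ BY}\ \vec v$, the selected keys are then grouped by the values of $\vec v$, which serve as the new opaque keys, and each aggregate $\gamma_i$ is applied to the bag of values of its argument at the keys selected for its column; a group in which no key is selected for this column has no entry, and without $\mathtt{GROUP\ BY}$ there is exactly one, possibly empty, group. $\mathtt{UNION\ ALL}$ is the disjoint union; $\mathtt{INTERSECT\ ALL}$, $\mathtt{EXCEPT\ ALL}$ and $\mathtt{DISTINCT}$ compare whole rows, two missing entries being the same, and their results get new opaque keys. **Proposition.** Let $Q_{3vl}$ be an SQL query. For every database instance $I$, let $O$ be the result of $Q_{3vl}$ on $I$ under the standard three-valued semantics, and let $I'$ be the Column Normal Form of $I$. 1. There is a query $Q_{cs}$, depending only on $Q_{3vl}$, such that for every instance $I$ the result $O'$ of $Q_{cs}$ on $I'$ under Columnar Semantics has full outer join $O$. 2. If $I$ is null-free and $Q_{3vl}$ is null-free (it contains no literal $\mathrm{NULL}$, and no aggregate of a query without $\mathtt{GROUP\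 BY}$ whose value on the empty bag is $\mathrm{NULL}$), then $Q_{cs}$ can be taken to be $Q_{3vl}$ itself: the full outer join of the result of $Q_{3vl}$ on $I'$ under Columnar Semantics is $O$. -/

import Mathlib

/-!
SQL queries on tables with nulls, their three-valued semantics, the Column Normal Form of a
database, and the Columnar Semantics of queries on databases in Column Normal Form.
-/

namespace ColumnarSQL

universe u

/-- The interpreted symbols of SQL over the domain `V` of (non-null) values: scalar functions
(such as `+`), predicates (such as `<`; equality is always available), and aggregate functions
(such as `COUNT`, `SUM`).  An aggregate maps a non-empty bag of values to a value; `aggEmpty` is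
its result on the empty bag, which may be a null (as for `SUM`) or a value (as for `COUNT`). -/
structure Vocabulary (V : Type u) where
  Fn : Type
  fnArity : Fn → ℕ
  fn : (f : Fn) → (Fin (fnArity f) → V) → V
  Pred : Type
  predArity : Pred → ℕ
  pred : (p : Pred) → (Fin (predArity p) → V) → Bool
  Agg : Type
  agg : Agg → Multiset V → V
  aggEmpty : Agg → Option V

/-- A database schema: table names with their numbers of columns. -/
structure Schema where
  Table : Type
  arity : Table → ℕ

/-! ### Syntax -/

/-- Expressions over `n` attributes. -/
inductive Expr {V : Type u} (S : Vocabulary V) (n : ℕ) : Type u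
  | attr (a : Fin n)
  | const (c : V)
  | null
  | app (f : S.Fn) (args : Fin (S.fnArity f) → Expr S n)

/-- Formulas over `n` attributes.  `missing a` is the construct `R MISSING a`; it is not part of
standard SQL, see `Query.IsSQL`. -/
inductive Formula {V : Type u} (S : Vocabulary V) (n : ℕ) : Type u
  | tt
  | eq (e₁ e₂ : Expr S n)
  | pred (p : S.Pred) (args : Fin (S.predArity p) → Expr S n)
  | isNull (e : Expr S n)
  | missing (a : Fin n)
  | and (φ ψ : Formula S n)
  | or (φ ψ : Formula S n)
  | not (φ : Formula S n)

/-- An entry of the `SELECT` list of an aggregate query whose `FROM` clause has `n` attributes and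
whose `GROUP BY` list has `j` attributes: an expression over the grouping attributes, or an
aggregate function applied to an expression. -/
inductive Item {V : Type u} (S : Vocabulary V) (n j : ℕ) : Type u
  | key (e : Expr S j)
  | agg (f : S.Agg) (e : Expr S n)

/-- Queries with `n` output columns.  The `FROM` list `R₁, R₂, …` is the iterated `cross` of its
members, which may be tables or subqueries.  Attributes are addressed by position.
* `select q φ e` is `SELECT e FROM q WHERE φ`;
* `group q φ v e` is `SELECT e FROM q WHERE φ GROUP BY v`, where an empty list `v` stands for an
  aggregate query without a `GROUP BY` clause;
* `union`, `inter`, `except` are `UNION ALL`, `INTERSECT ALL`, `EXCEPT ALL`. -/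
inductive Query {V : Type u} (S : Vocabulary V) (D : Schema) : ℕ → Type u
  | table (t : D.Table) : Query S D (D.arity t)
  | cross {m n : ℕ} (q₁ : Query S D m) (q₂ : Query S D n) : Query S D (m + n)
  | select {n k : ℕ} (q : Query S D n) (φ : Formula S n) (e : Fin k → Expr S n) : Query S D k
  | group {n j k : ℕ} (q : Query S D n) (φ : Formula S n) (v : Fin j → Fin n)
      (e : Fin k → Item S n j) : Query S D k
  | union {n : ℕ} (q₁ q₂ : Query S D n) : Query S D n
  | inter {n : ℕ} (q₁ q₂ : Query S D n) : Query S D n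
  | except {n : ℕ} (q₁ q₂ : Query S D n) : Query S D n
  | distinct {n : ℕ} (q : Query S D n) : Query S D n

section Syntax_predicates

variable {V : Type u} {S : Vocabulary V} {D : Schema}

/-- The attributes mentioned in an expression. -/
def Expr.attrs {n : ℕ} : Expr S n → Finset (Fin n)
  | .attr a => {a}
  | .const _ => ∅
  | .null => ∅
  | .app _ args => Finset.univ.biUnion fun i => (args i).attrs

/-- The attributes mentioned in a formula.  `R MISSING a` abbreviates
`R_id.id NOT IN (SELECT id FROM R_a)`, which does not mention the attribute `R.a`. -/
def Formula.attrs {n : ℕ} : Formula S n → Finset (Fin n)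
  | .tt => ∅
  | .eq e₁ e₂ => e₁.attrs ∪ e₂.attrs
  | .pred _ args => Finset.univ.biUnion fun i => (args i).attrs
  | .isNull e => e.attrs
  | .missing _ => ∅
  | .and φ ψ => φ.attrs ∪ ψ.attrs
  | .or φ ψ => φ.attrs ∪ ψ.attrs
  | .not φ => φ.attrs

/-- No literal `NULL` occurs. -/
def Expr.NullFree {n : ℕ} : Expr S n → Prop
  | .attr _ => True
  | .const _ => True
  | .null => False
  | .app _ args => ∀ i, (args i).NullFree

/-- No literal `NULL` occurs. -/
def Formula.NullFree {n : ℕ} : Formula S n → Prop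
  | .tt => True
  | .eq e₁ e₂ => e₁.NullFree ∧ e₂.NullFree
  | .pred _ args => ∀ i, (args i).NullFree
  | .isNull e => e.NullFree
  | .missing _ => True
  | .and φ ψ => φ.NullFree ∧ ψ.NullFree
  | .or φ ψ => φ.NullFree ∧ ψ.NullFree
  | .not φ => φ.NullFree

/-- The item does not introduce nulls: it has no literal `NULL`, and if it is an aggregate of a
query without `GROUP BY`, then it is not null on the empty bag. -/
def Item.NullFree {n j : ℕ} : Item S n j → Prop
  | .key e => e.NullFree
  | .agg f e => e.NullFree ∧ (j = 0 → (S.aggEmpty f).isSome)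

/-- A null-free query: it does not introduce nulls of its own. -/
def Query.NullFree {n : ℕ} : Query S D n → Prop
  | .table _ => True
  | .cross q₁ q₂ => q₁.NullFree ∧ q₂.NullFree
  | .select q φ e => q.NullFree ∧ φ.NullFree ∧ ∀ c, (e c).NullFree
  | .group q φ _ e => q.NullFree ∧ φ.NullFree ∧ ∀ c, (e c).NullFree
  | .union q₁ q₂ => q₁.NullFree ∧ q₂.NullFree
  | .inter q₁ q₂ => q₁.NullFree ∧ q₂.NullFree
  | .except q₁ q₂ => q₁.NullFree ∧ q₂.NullFree
  | .distinct q => q.NullFree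

/-- No occurrence of `MISSING`. -/
def Formula.IsSQL {n : ℕ} : Formula S n → Prop
  | .tt => True
  | .eq _ _ => True
  | .pred _ _ => True
  | .isNull _ => True
  | .missing _ => False
  | .and φ ψ => φ.IsSQL ∧ ψ.IsSQL
  | .or φ ψ => φ.IsSQL ∧ ψ.IsSQL
  | .not φ => φ.IsSQL

/-- A query of standard SQL: no occurrence of `MISSING`. -/
def Query.IsSQL {n : ℕ} : Query S D n → Prop
  | .table _ => True
  | .cross q₁ q₂ => q₁.IsSQL ∧ q₂.IsSQL
  | .select q φ _ => q.IsSQL ∧ φ.IsSQL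
  | .group q φ _ _ => q.IsSQL ∧ φ.IsSQL
  | .union q₁ q₂ => q₁.IsSQL ∧ q₂.IsSQL
  | .inter q₁ q₂ => q₁.IsSQL ∧ q₂.IsSQL
  | .except q₁ q₂ => q₁.IsSQL ∧ q₂.IsSQL
  | .distinct q => q.IsSQL

end Syntax_predicates

/-! ### Evaluation of expressions and formulas -/

/-- The truth values `TRUE`, `FALSE`, `UNKNOWN`. -/
inductive Truth : Type
  | t | f | u
  deriving DecidableEq

/-- Kleene's conjunction. -/
def Truth.and : Truth → Truth → Truth
  | .t, y => y
  | .f, _ => .f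
  | .u, .f => .f
  | .u, _ => .u

/-- Kleene's disjunction. -/
def Truth.or : Truth → Truth → Truth
  | .t, _ => .t
  | .f, y => y
  | .u, .t => .t
  | .u, _ => .u

/-- Kleene's negation. -/
def Truth.not : Truth → Truth
  | .t => .f
  | .f => .t
  | .u => .u

/-- A Boolean as a truth value. -/
def Truth.ofBool (b : Bool) : Truth := if b then .t else .f

/-- A row with `n` columns, `none` being `NULL`. -/
abbrev Row (V : Type u) (n : ℕ) : Type u := Fin n → Option V

/-- The arguments as a tuple of values, if none of them is null. -/
def values {V : Type u} {m : ℕ} (x : Fin m → Option V) : Option (Fin m → V) :=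
  if h : ∀ i, (x i).isSome then some fun i => (x i).get (h i) else none

section Evaluation

variable {V : Type u} [DecidableEq V] {S : Vocabulary V}

/-- The value of an expression; any null argument makes it null. -/
def Expr.eval {n : ℕ} (r : Row V n) : Expr S n → Option V
  | .attr a => r a
  | .const c => some c
  | .null => none
  | .app f args => (values fun i => (args i).eval r).map (S.fn f)

/-- The truth value of a formula; a predicate with a null argument is `UNKNOWN`, and `IS NULL` is
two-valued. -/
def Formula.eval {n : ℕ} (r : Row V n) : Formula S n → Truth
  | .tt => .t
  | .eq e₁ e₂ =>
      match e₁.eval r, e₂.eval r with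
      | some x, some y => Truth.ofBool (decide (x = y))
      | _, _ => .u
  | .pred p args =>
      match values fun i => (args i).eval r with
      | some x => Truth.ofBool (S.pred p x)
      | none => .u
  | .isNull e => Truth.ofBool (e.eval r).isNone
  | .missing a => Truth.ofBool (r a).isNone
  | .and φ ψ => (φ.eval r).and (ψ.eval r)
  | .or φ ψ => (φ.eval r).or (ψ.eval r)
  | .not φ => (φ.eval r).not

/-- Application of an aggregate function to a bag; any null input makes the output null. -/
def aggregate (S : Vocabulary V) (f : S.Agg) (b : Multiset (Option V)) : Option V :=
  if none ∈ b then none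
  else if b = 0 then S.aggEmpty f
  else some (S.agg f (b.filterMap id))

/-! ### The standard semantics -/

/-- A database instance: every table is a finite list of rows, which may contain nulls.  Queries
see the table as a bag; the order only serves to number the rows. -/
abbrev Instance (V : Type u) (D : Schema) : Type u := (t : D.Table) → List (Row V (D.arity t))

/-- No null occurs in the instance. -/
def Instance.NullFree {V : Type u} {D : Schema} (I : Instance V D) : Prop :=
  ∀ t, ∀ r ∈ I t, ∀ a, r a ≠ none

/-- The value of an item on the group `g` with grouping values `x`. -/
def Item.eval {n j : ℕ} (x : Row V j) (g : Multiset (Row V n)) : Item S n j → Option V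
  | .key e => e.eval x
  | .agg f e => aggregate S f (g.map fun r => e.eval r)

/-- The result of a query under the standard three-valued semantics, a bag of rows.  For grouping,
`INTERSECT`, `EXCEPT` and `DISTINCT` two nulls are the same; an aggregate query without `GROUP BY`
has exactly one, possibly empty, group. -/
def Query.eval {D : Schema} (I : Instance V D) {n : ℕ} : Query S D n → Multiset (Row V n)
  | .table t => (I t : Multiset (Row V (D.arity t)))
  | .cross q₁ q₂ => (q₁.eval I ×ˢ q₂.eval I).map fun p => Fin.append p.1 p.2
  | .select q φ e =>
      ((q.eval I).filter fun r => φ.eval r = .t).map fun r c => (e c).eval r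
  | .group (j := j) q φ v e =>
      let rows := (q.eval I).filter fun r => φ.eval r = .t
      let keys : Multiset (Row V j) :=
        if j = 0 then {fun _ => none} else (rows.map fun r a => r (v a)).dedup
      keys.map fun x c => (e c).eval x (rows.filter fun r => (fun a => r (v a)) = x)
  | .union q₁ q₂ => q₁.eval I + q₂.eval I
  | .inter q₁ q₂ => q₁.eval I ∩ q₂.eval I
  | .except q₁ q₂ => q₁.eval I - q₂.eval I
  | .distinct q => (q.eval I).dedup

end Evaluation

/-! ### Column Normal Form -/

/-- Opaque keys.  Rows of stored tables are numbered, rows of a cross product have pairs of keys,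
rows of a union have tagged keys, and groups are identified by the values of the grouping
attributes.  No query can access a key. -/
inductive Key (V : Type u) : Type u
  | row (i : ℕ)
  | pair (i j : Key V)
  | left (i : Key V)
  | right (i : Key V)
  | group (l : List V)
  deriving DecidableEq

/-- A relation with `n` columns in Column Normal Form: the unary relation `ids` of keys and, for
every column, a binary relation that maps keys to values.  There are no nulls: missing information
is an absent entry. -/
structure ColRel (V : Type u) (n : ℕ) where
  ids : Finset (Key V)
  col : Fin n → Finset (Key V × V)
  mem_ids : ∀ a i x, (i, x) ∈ col a → i ∈ ids
  unique : ∀ a i x y, (i, x) ∈ col a → (i, y) ∈ col a → x = y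

section ColumnNormalForm

variable {V : Type u} [DecidableEq V]

/-- The relation in Column Normal Form with the given keys whose column `a` consists of the pairs
`(i, x)` with `f a i = some x`. -/
def ColRel.ofEntries {n : ℕ} (ids : Finset (Key V)) (f : Fin n → Key V → Option V) :
    ColRel V n where
  ids := ids
  col a := ids.biUnion fun i => (f a i).toFinset.image fun x => (i, x)
  mem_ids a i x h := by
    simp only [Finset.mem_biUnion, Finset.mem_image, Prod.mk.injEq] at h
    obtain ⟨i', hi', _, _, rfl, _⟩ := h
    exact hi'
  unique a i x y hx hy := by
    simp only [Finset.mem_biUnion, Finset.mem_image, Prod.mk.injEq, Option.mem_toFinset,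
      Option.mem_def] at hx hy
    obtain ⟨_, _, _, hx, rfl, rfl⟩ := hx
    obtain ⟨_, _, _, hy, rfl, rfl⟩ := hy
    rw [hx] at hy
    exact Option.some.inj hy

open Classical in
/-- The value in column `a` that is correlated with the key `i`, if there is one. -/
noncomputable def ColRel.entry {n : ℕ} (R : ColRel V n) (i : Key V) (a : Fin n) : Option V :=
  if h : ∃ x, (i, x) ∈ R.col a then some h.choose else none

/-- The full outer join, on the keys, of the relation of keys and all columns; the keys are then
dropped.  Absent entries become nulls. -/
noncomputable def ColRel.fullOuterJoin {n : ℕ} (R : ColRel V n) : Multiset (Row V n) :=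
  R.ids.val.map fun i a => R.entry i a

/-- The Column Normal Form of a table, keyed by row numbers. -/
def normalize {n : ℕ} (T : List (Row V n)) : ColRel V n :=
  ColRel.ofEntries ((Finset.range T.length).image Key.row) fun a i =>
    match i with
    | .row i => T[i]?.bind fun r => r a
    | _ => none

/-- A database in Column Normal Form. -/
abbrev ColInstance (V : Type u) (D : Schema) : Type u := (t : D.Table) → ColRel V (D.arity t)

/-- The Column Normal Form of a database instance. -/
def Instance.normalize {D : Schema} (I : Instance V D) : ColInstance V D :=
  fun t => ColumnarSQL.normalize (I t)

/-! ### Columnar Semantics -/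

/-- The key `i` can be joined with every column in `A`. -/
def ColRel.Joins {n : ℕ} (R : ColRel V n) (A : Finset (Fin n)) (i : Key V) : Prop :=
  ∀ a ∈ A, (R.entry i a).isSome

noncomputable instance {n : ℕ} (R : ColRel V n) (A : Finset (Fin n)) (i : Key V) :
    Decidable (R.Joins A i) :=
  inferInstanceAs (Decidable (∀ a ∈ A, (R.entry i a).isSome))

variable {S : Vocabulary V}

/-- The keys which the expanded query `SELECT ids FROM … WHERE expand(φ)` selects, when it joins
the columns in `A` (those of the selected expression and of `GROUP BY`) and the columns mentioned
in `φ`: all these columns have an entry correlated with the key, and `φ` is true of the entries. -/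
noncomputable def ColRel.expanded {n : ℕ} (R : ColRel V n) (φ : Formula S n) (A : Finset (Fin n)) :
    Finset (Key V) :=
  R.ids.filter fun i => R.Joins (φ.attrs ∪ A) i ∧ φ.eval (R.entry i) = .t

/-- Cross product; keys are paired. -/
noncomputable def ColRel.cross {m n : ℕ} (R : ColRel V m) (T : ColRel V n) : ColRel V (m + n) :=
  ColRel.ofEntries ((R.ids ×ˢ T.ids).image fun p => Key.pair p.1 p.2) fun a k =>
    match k with
    | .pair i j => Fin.append (R.entry i) (T.entry j) a
    | _ => none

/-- Disjoint union; keys are tagged. -/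
noncomputable def ColRel.union {n : ℕ} (R T : ColRel V n) : ColRel V n :=
  ColRel.ofEntries (R.ids.image Key.left ∪ T.ids.image Key.right) fun a k =>
    match k with
    | .left i => R.entry i a
    | .right i => T.entry i a
    | _ => none

/-- `SELECT e FROM R WHERE φ`: one expanded query for the keys, and one for each `e c`. -/
noncomputable def ColRel.select {n k : ℕ} (R : ColRel V n) (φ : Formula S n)
    (e : Fin k → Expr S n) : ColRel V k :=
  ColRel.ofEntries (R.expanded φ ∅) fun c i =>
    if i ∈ R.expanded φ (e c).attrs then (e c).eval (R.entry i) else none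

/-- The key of the group of `i`. -/
noncomputable def ColRel.groupKey {n j : ℕ} (R : ColRel V n) (v : Fin j → Fin n) (i : Key V) :
    Key V :=
  .group (List.ofFn fun a => R.entry i (v a)).reduceOption

/-- `SELECT e FROM R WHERE φ GROUP BY v`: one expanded query for the keys of the groups, and one
for each `e c`.  The expanded query of an aggregate forms its groups from the entries that join;
without `GROUP BY` there is exactly one, possibly empty, group. -/
noncomputable def ColRel.group {n j k : ℕ} (R : ColRel V n) (φ : Formula S n) (v : Fin j → Fin n)
    (e : Fin k → Item S n j) : ColRel V k :=
  ColRel.ofEntries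
    (if j = 0 then {Key.group []}
      else (R.expanded φ (Finset.univ.image v)).image (R.groupKey v))
    fun c g =>
      match e c, g with
      | .key e, .group l => e.eval fun a => l[(a : ℕ)]?
      | .agg f e, g =>
          let rows := (R.expanded φ (Finset.univ.image v ∪ e.attrs)).filter
            fun i => R.groupKey v i = g
          if rows = ∅ ∧ j ≠ 0 then none
          else aggregate S f (rows.val.map fun i => e.eval (R.entry i))
      | _, _ => none

/-- The result of a query under Columnar Semantics, a relation in Column Normal Form.
`INTERSECT`, `EXCEPT` and `DISTINCT` compare whole rows, two missing entries being the same, and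
their results get new opaque keys. -/
noncomputable def Query.columnar {D : Schema} (J : ColInstance V D) {n : ℕ} :
    Query S D n → ColRel V n
  | .table t => J t
  | .cross q₁ q₂ => (q₁.columnar J).cross (q₂.columnar J)
  | .select q φ e => (q.columnar J).select φ e
  | .group q φ v e => (q.columnar J).group φ v e
  | .union q₁ q₂ => (q₁.columnar J).union (q₂.columnar J)
  | .inter q₁ q₂ => ColumnarSQL.normalize
      ((q₁.columnar J).fullOuterJoin ∩ (q₂.columnar J).fullOuterJoin).toList
  | .except q₁ q₂ => ColumnarSQL.normalize
      ((q₁.columnar J).fullOuterJoin - (q₂.columnar J).fullOuterJoin).toList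
  | .distinct q => ColumnarSQL.normalize (q.columnar J).fullOuterJoin.dedup.toList

end ColumnNormalForm

end ColumnarSQL

/-! ### Bags: duplicates and partitions. -/

namespace Multiset

/-! After a full outer join, every operation of Columnar Semantics becomes an operation on bags of
rows. Most agree with the standard ones. The exceptions are: `WHERE` also discards rows lacking an
attribute of the formula; grouping discards rows lacking a grouping value; an aggregate skips rows
lacking an attribute of its argument, where the standard one returns null.

Part 1 follows by induction on the query once the functions of the instance computed by columnar
queries (`Definable`) are closed under the standard operations.

`Definable.filter`: cut the bag by the set `M` of missing columns, using `MISSING` alone, which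
requires no entries. On each piece, writing `NULL` for the attributes in `M` keeps the truth value
and leaves only present attributes. The disjoint union of the finitely many pieces is the standard
selection. This gives semijoins and, with `EXCEPT ALL`, antijoins.

`Definable.groupBy`: if all grouping values are present, the columnar result is wrong only in groups
where an aggregate has a null argument. Their keys are definable, and a semijoin with them nulls the
entry (`Definable.groupBy_of_isSome`). In general, cut the rows by the pattern of null grouping
values, fill these nulls with a fixed value, group, and restore the nulls in the key expressions
(`groupBy_fill`).

For part 2, all intermediate results are null-free, so requiring entries discards nothing, and the
two semantics agree at each operation. -/

theorem dedup_map_of_injOn {α β : Type*} [DecidableEq α] [DecidableEq β] {f : α → β}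
    {s : Multiset α} (hf : ∀ a ∈ s, ∀ b ∈ s, f a = f b → a = b) :
    (s.map f).dedup = s.dedup.map f := by
  refine (Nodup.ext (nodup_dedup _) (Nodup.map_on ?_ (nodup_dedup s))).2 fun x => by simp
  simpa using hf

theorem dedup_filter {α : Type*} [DecidableEq α] (p : α → Prop) [DecidablePred p]
    (s : Multiset α) : (s.filter p).dedup = s.dedup.filter p :=
  (Nodup.ext (nodup_dedup _) ((nodup_dedup s).filter p)).2 fun x => by simp

/-- Each element lies in exactly one fibre of `g`. This reassembles a bag from pieces cut by the
pattern of missing entries. -/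
theorem sum_filter_eq {α ι : Type*} [DecidableEq α] [Fintype ι] [DecidableEq ι] (g : α → ι)
    (s : Multiset α) : ∑ i, s.filter (fun a => g a = i) = s := by
  ext a
  simp [count_sum', count_filter]

end Multiset

namespace ColumnarSQL

universe u

variable {V : Type u}

/-! ### Expressions and formulas -/

theorem values_eq_none {m : ℕ} {x : Fin m → Option V} : values x = none ↔ ∃ i, x i = none := by
  unfold values
  split <;> rename_i h
  · simp only [reduceCtorEq, false_iff, not_exists]
    intro i hi
    simpa [hi] using h i
  · simpa using h

/-- The row `r` has an entry in every column of `A`. -/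
def Present {n : ℕ} (A : Finset (Fin n)) (r : Row V n) : Prop := ∀ a ∈ A, (r a).isSome

instance {n : ℕ} (A : Finset (Fin n)) : DecidablePred (Present (V := V) A) :=
  fun r => inferInstanceAs (Decidable (∀ a ∈ A, (r a).isSome))

theorem present_empty {n : ℕ} (r : Row V n) : Present ∅ r := by simp [Present]

theorem present_union {n : ℕ} {A B : Finset (Fin n)} {r : Row V n} :
    Present (A ∪ B) r ↔ Present A r ∧ Present B r := by
  simp only [Present, Finset.mem_union, or_imp, forall_and]

variable {S : Vocabulary V}

/-- Functions are strict, so one missing attribute anywhere makes the whole expression null. -/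
theorem Expr.present_of_eval_ne_none {n : ℕ} {r : Row V n} {e : Expr S n}
    (h : e.eval r ≠ none) : Present e.attrs r := by
  induction e with
  | attr a => simpa [Present, Expr.attrs, Expr.eval, Option.isSome_iff_ne_none] using h
  | const c => simp [Present, Expr.attrs]
  | null => simp [Present, Expr.attrs]
  | app f args ih =>
    intro a ha
    simp only [Expr.attrs, Finset.mem_biUnion, Finset.mem_univ, true_and] at ha
    obtain ⟨i, hi⟩ := ha
    refine ih i (fun h' => h ?_) a hi
    simp only [Expr.eval, Option.map_eq_none_iff]
    exact values_eq_none.2 ⟨i, h'⟩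

theorem Expr.NullFree.eval_ne_none {n : ℕ} {r : Row V n} {e : Expr S n} (he : e.NullFree)
    (hr : ∀ a, r a ≠ none) : e.eval r ≠ none := by
  induction e with
  | attr a => exact hr a
  | const c => simp [Expr.eval]
  | null => exact he.elim
  | app f args ih =>
    simp only [Expr.eval, ne_eq, Option.map_eq_none_iff, values_eq_none, not_exists]
    exact fun i => ih i (he i)

/-- Substitution of expressions for attributes. -/
def Expr.subst {m n : ℕ} (σ : Fin n → Expr S m) : Expr S n → Expr S m
  | .attr a => σ a
  | .const c => .const c
  | .null => .null
  | .app f args => .app f fun i => (args i).subst σ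

theorem Expr.eval_subst {m n : ℕ} (σ : Fin n → Expr S m) (r : Row V m) (e : Expr S n) :
    (e.subst σ).eval r = e.eval fun a => (σ a).eval r := by
  induction e with
  | app f args ih => simp only [Expr.subst, Expr.eval, ih]
  | _ => rfl

/-- The attributes in `M` are replaced by `NULL`. -/
def Expr.nullify {n : ℕ} (M : Finset (Fin n)) : Expr S n → Expr S n :=
  Expr.subst fun a => if a ∈ M then .null else .attr a

theorem Expr.eval_nullify {n : ℕ} (M : Finset (Fin n)) (r : Row V n) (e : Expr S n) :
    (e.nullify M).eval r = e.eval fun a => if a ∈ M then none else r a := by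
  rw [Expr.nullify, Expr.eval_subst]
  congr 1
  ext1 a
  split <;> rfl

theorem Expr.disjoint_attrs_nullify {n : ℕ} (M : Finset (Fin n)) (e : Expr S n) :
    Disjoint (e.nullify M).attrs M := by
  induction e with
  | attr a =>
    by_cases ha : a ∈ M <;> simp [Expr.nullify, Expr.subst, Expr.attrs, ha]
  | const c => simp [Expr.nullify, Expr.subst, Expr.attrs]
  | null => simp [Expr.nullify, Expr.subst, Expr.attrs]
  | app f args ih =>
    simp only [Expr.nullify, Expr.subst, Expr.attrs, Finset.disjoint_biUnion_left] at ih ⊢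
    exact fun i _ => ih i

/-- The attributes in `M` are replaced by `NULL`, except in `MISSING`. -/
def Formula.nullify {n : ℕ} (M : Finset (Fin n)) : Formula S n → Formula S n
  | .tt => .tt
  | .eq e₁ e₂ => .eq (e₁.nullify M) (e₂.nullify M)
  | .pred p args => .pred p fun i => (args i).nullify M
  | .isNull e => .isNull (e.nullify M)
  | .missing a => .missing a
  | .and φ ψ => .and (φ.nullify M) (ψ.nullify M)
  | .or φ ψ => .or (φ.nullify M) (ψ.nullify M)
  | .not φ => .not (φ.nullify M)

theorem Formula.disjoint_attrs_nullify {n : ℕ} (M : Finset (Fin n)) (φ : Formula S n) :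
    Disjoint (φ.nullify M).attrs M := by
  induction φ <;>
    simp_all [Formula.nullify, Formula.attrs, Expr.disjoint_attrs_nullify,
      Finset.disjoint_union_left, Finset.disjoint_biUnion_left]

/-- The conjunction of a finite family of formulas. -/
def Formula.all {m n : ℕ} (φ : Fin m → Formula S n) : Formula S n :=
  (List.ofFn φ).foldr .and .tt

theorem Formula.attrs_all {m n : ℕ} {φ : Fin m → Formula S n} (h : ∀ i, (φ i).attrs = ∅) :
    (Formula.all φ).attrs = ∅ := by
  have (l : List (Formula S n)) (hl : ∀ ψ ∈ l, ψ.attrs = ∅) :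
      (l.foldr .and .tt : Formula S n).attrs = ∅ := by
    induction l with
    | nil => rfl
    | cons ψ l ih => simp_all [Formula.attrs]
  exact this _ fun ψ hψ => by
    obtain ⟨i, rfl⟩ := (List.mem_ofFn' φ ψ).1 hψ
    exact h i

theorem Truth.and_eq_t {x y : Truth} : x.and y = .t ↔ x = .t ∧ y = .t := by
  cases x <;> cases y <;> simp [Truth.and]

theorem Truth.or_eq_t {x y : Truth} : x.or y = .t ↔ x = .t ∨ y = .t := by
  cases x <;> cases y <;> simp [Truth.or]

theorem Truth.not_eq_t {x : Truth} : x.not = .t ↔ x = .f := by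
  cases x <;> simp [Truth.not]

theorem Truth.ofBool_eq_t {b : Bool} : Truth.ofBool b = .t ↔ b = true := by
  cases b <;> simp [Truth.ofBool]

theorem Truth.ofBool_eq_f {b : Bool} : Truth.ofBool b = .f ↔ b = false := by
  cases b <;> simp [Truth.ofBool]

/-- The columns without an entry. -/
def missingSet {n : ℕ} (r : Row V n) : Finset (Fin n) := Finset.univ.filter fun a => r a = none

theorem mem_missingSet {n : ℕ} {r : Row V n} {a : Fin n} : a ∈ missingSet r ↔ r a = none := by
  simp [missingSet]

/-- The columns `v a` without an entry are those with `a ∈ M`. -/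
def Formula.mask {n j : ℕ} (v : Fin j → Fin n) (M : Finset (Fin j)) : Formula S n :=
  .all fun a => if a ∈ M then .missing (v a) else .not (.missing (v a))

/-- A mask is built from `MISSING` alone, so Columnar Semantics evaluates it without requiring any
entry. -/
theorem Formula.attrs_mask {n j : ℕ} (v : Fin j → Fin n) (M : Finset (Fin j)) :
    (Formula.mask v M : Formula S n).attrs = ∅ :=
  Formula.attrs_all fun a => by split <;> rfl

theorem ColRel.entry_eq_some {n : ℕ} {R : ColRel V n} {i : Key V} {a : Fin n} {x : V} :
    R.entry i a = some x ↔ (i, x) ∈ R.col a := by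
  unfold ColRel.entry
  split <;> rename_i h
  · rw [Option.some_inj]
    exact ⟨fun hx => hx ▸ h.choose_spec, fun hx => R.unique a i _ _ h.choose_spec hx⟩
  · simpa using fun hx => h ⟨x, hx⟩

/-- The grouping values that are represented by a key. -/
def Key.decode (j : ℕ) : Key V → Row V j
  | .group l => fun a => l[(a : ℕ)]?
  | _ => fun _ => none

/-- Dropping nulls shifts positions in general; when all values are present nothing is dropped and
the list determines the row. -/
theorem Key.decode_group_reduceOption {j : ℕ} {x : Row V j} (h : ∀ a, (x a).isSome) :
    (Key.group (List.ofFn x).reduceOption).decode j = x := by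
  obtain ⟨y, rfl⟩ : ∃ y : Fin j → V, x = fun a => some (y a) :=
    ⟨fun a => (x a).get (h a), by simp⟩
  have : (List.ofFn fun a => some (y a)).reduceOption = List.ofFn y := by
    rw [show (List.ofFn fun a => some (y a)) = (List.ofFn y).map some by
      simp [List.map_ofFn, Function.comp_def], List.reduceOption, List.filterMap_map]
    simp
  ext1 a
  simp [this, Key.decode]

theorem present_image {n j : ℕ} {v : Fin j → Fin n} {r : Row V n} :
    Present (Finset.univ.image v) r ↔ ∀ a, (r (v a)).isSome := by
  simp [Present]

variable [DecidableEq V]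

theorem Formula.eval_all {m n : ℕ} {φ : Fin m → Formula S n} {r : Row V n} :
    (Formula.all φ).eval r = .t ↔ ∀ i, (φ i).eval r = .t := by
  have (l : List (Formula S n)) :
      (l.foldr .and .tt : Formula S n).eval r = .t ↔ ∀ ψ ∈ l, ψ.eval r = .t := by
    induction l with
    | nil => simp [Formula.eval]
    | cons ψ l ih => simp [Formula.eval, Truth.and_eq_t, ih]
  rw [Formula.all, this]
  simp [List.mem_ofFn']

theorem Formula.eval_nullify {n : ℕ} {M : Finset (Fin n)} {r : Row V n}
    (h : ∀ a ∈ M, r a = none) (φ : Formula S n) : (φ.nullify M).eval r = φ.eval r := by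
  have hr : (fun a => if a ∈ M then none else r a) = r := by
    ext1 a
    split <;> simp_all
  induction φ <;> simp_all only [Formula.nullify, Formula.eval, Expr.eval_nullify]

theorem Formula.eval_mask {n j : ℕ} {v : Fin j → Fin n} {M : Finset (Fin j)} {r : Row V n} :
    (Formula.mask v M : Formula S n).eval r = .t ↔ missingSet (fun a => r (v a)) = M := by
  rw [Formula.mask, Formula.eval_all, Finset.ext_iff]
  refine forall_congr' fun a => ?_
  rw [mem_missingSet]
  by_cases ha : a ∈ M <;>
    simp [ha, Formula.eval, Truth.ofBool_eq_t, Truth.not_eq_t, Truth.ofBool_eq_f,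
      Option.isSome_iff_ne_none]

/-- The attributes have the same entry, two missing entries being the same. -/
def Formula.same {n : ℕ} (a b : Fin n) : Formula S n :=
  .or (.and (.missing a) (.missing b)) (.eq (.attr a) (.attr b))

/-- Equality is `UNKNOWN` on two nulls, so the `MISSING` disjunct supplies that case; with exactly
one null neither disjunct is true. -/
theorem Formula.eval_same {n : ℕ} {a b : Fin n} {r : Row V n} :
    (Formula.same a b : Formula S n).eval r = .t ↔ r a = r b := by
  simp only [Formula.same, Formula.eval, Truth.or_eq_t, Truth.and_eq_t, Truth.ofBool_eq_t,
    Expr.eval]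
  cases r a <;> cases r b <;> simp [Truth.ofBool_eq_t]

/-! ### The rows of a relation in Column Normal Form -/

theorem ColRel.entry_ofEntries {n : ℕ} {ids : Finset (Key V)} {f : Fin n → Key V → Option V}
    {i : Key V} (hi : i ∈ ids) (a : Fin n) : (ColRel.ofEntries ids f).entry i a = f a i := by
  ext x
  rw [ColRel.entry_eq_some]
  simp only [ColRel.ofEntries, Finset.mem_biUnion, Finset.mem_image, Option.mem_toFinset,
    Option.mem_def, Prod.mk.injEq]
  constructor
  · rintro ⟨_, _, _, h, rfl, rfl⟩
    exact h
  · exact fun h => ⟨i, hi, x, h, rfl, rfl⟩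

theorem ColRel.fullOuterJoin_ofEntries {n : ℕ} (ids : Finset (Key V))
    (f : Fin n → Key V → Option V) :
    (ColRel.ofEntries ids f).fullOuterJoin = ids.val.map fun i a => f a i :=
  Multiset.map_congr rfl fun _ hi => funext fun a => ColRel.entry_ofEntries hi a

theorem fullOuterJoin_normalize {n : ℕ} (T : List (Row V n)) :
    (normalize T).fullOuterJoin = T := by
  rw [normalize, ColRel.fullOuterJoin_ofEntries,
    Finset.image_val_of_injOn (fun i _ k _ h => Key.row.inj h), Multiset.map_map]
  simp only [Finset.range_val, Multiset.range, Multiset.map_coe, Multiset.coe_eq_coe]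
  refine List.Perm.of_eq (List.ext_getElem (by simp) fun i h₁ h₂ => ?_)
  ext1 a
  simp [h₂]

theorem ColRel.fullOuterJoin_cross {m n : ℕ} (R : ColRel V m) (T : ColRel V n) :
    (R.cross T).fullOuterJoin =
      (R.fullOuterJoin ×ˢ T.fullOuterJoin).map fun p => Fin.append p.1 p.2 := by
  have h : Set.InjOn (fun p : Key V × Key V => Key.pair p.1 p.2) ↑(R.ids ×ˢ T.ids) := by
    rintro ⟨i, k⟩ _ ⟨i', k'⟩ _ h
    simpa using h
  rw [ColRel.cross, ColRel.fullOuterJoin_ofEntries, Finset.image_val_of_injOn h, Multiset.map_map]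
  have : R.fullOuterJoin ×ˢ T.fullOuterJoin =
      (R.ids.val ×ˢ T.ids.val).map fun p => (R.entry p.1, T.entry p.2) := by
    simp only [ColRel.fullOuterJoin, SProd.sprod, Multiset.product, Multiset.map_bind,
      Multiset.bind_map, Multiset.map_map, Function.comp_def]
  rw [this, Multiset.map_map]
  rfl

theorem ColRel.fullOuterJoin_union {n : ℕ} (R T : ColRel V n) :
    (R.union T).fullOuterJoin = R.fullOuterJoin + T.fullOuterJoin := by
  have hd : Disjoint (R.ids.image Key.left) (T.ids.image Key.right) := by
    rw [Finset.disjoint_left]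
    simp
  rw [ColRel.union, ColRel.fullOuterJoin_ofEntries, ← Finset.disjUnion_eq_union _ _ hd,
    Finset.disjUnion_val, Multiset.map_add,
    Finset.image_val_of_injOn (fun i _ k _ h => Key.left.inj h),
    Finset.image_val_of_injOn (fun i _ k _ h => Key.right.inj h), Multiset.map_map,
    Multiset.map_map]
  rfl

/-- Transfers the selection of keys to the joined rows, where it is a filter. -/
theorem ColRel.map_expanded {n : ℕ} {β : Type*} (R : ColRel V n) (φ : Formula S n)
    (A : Finset (Fin n)) (g : Row V n → β) :
    (R.expanded φ A).val.map (fun i => g (R.entry i)) =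
      (R.fullOuterJoin.filter fun r => Present (φ.attrs ∪ A) r ∧ φ.eval r = .t).map g := by
  rw [ColRel.expanded, Finset.filter_val, ColRel.fullOuterJoin, Multiset.filter_map,
    Multiset.map_map]
  refine congrArg₂ _ rfl (Multiset.filter_congr fun i _ => ?_)
  rfl

/-- The column of `e c` also requires the attributes of `e c`, but this loses nothing: where one is
missing, the value is null by strictness. Only the attributes of `φ` matter. -/
theorem ColRel.fullOuterJoin_select {n k : ℕ} (R : ColRel V n) (φ : Formula S n)
    (e : Fin k → Expr S n) :
    (R.select φ e).fullOuterJoin =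
      (R.fullOuterJoin.filter fun r => Present φ.attrs r ∧ φ.eval r = .t).map
        fun r c => (e c).eval r := by
  have := R.map_expanded φ ∅ fun r c => (e c).eval r
  rw [Finset.union_empty] at this
  rw [ColRel.select, ColRel.fullOuterJoin_ofEntries, ← this]
  refine Multiset.map_congr rfl fun i hi => funext fun c => ?_
  split <;> rename_i h
  · rfl
  · by_contra hne
    have hp := Expr.present_of_eval_ne_none (Ne.symm hne)
    simp only [ColRel.expanded, Finset.mem_val, Finset.mem_filter] at hi h
    exact h ⟨hi.1, present_union.2 ⟨(present_union.1 hi.2.1).1, hp⟩, hi.2.2⟩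

/-- The value of an item on a group under Columnar Semantics. -/
def Item.columnarEval {n j : ℕ} (x : Row V j) (g : Multiset (Row V n)) :
    Item S n j → Option V
  | .key e => e.eval x
  | .agg f e =>
      let g' := g.filter (Present e.attrs)
      if g' = 0 ∧ j ≠ 0 then none else aggregate S f (g'.map fun r => e.eval r)

/-- The grouping values of the groups of `rows`. -/
def groupKeys {n j : ℕ} (rows : Multiset (Row V n)) (v : Fin j → Fin n) : Multiset (Row V j) :=
  if j = 0 then {fun _ => none} else (rows.map fun r a => r (v a)).dedup

/-- Grouping with items that are evaluated by `ev`. -/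
def groupBy {n j k : ℕ} (ev : Row V j → Multiset (Row V n) → Item S n j → Option V)
    (rows : Multiset (Row V n)) (v : Fin j → Fin n) (e : Fin k → Item S n j) :
    Multiset (Row V k) :=
  (groupKeys rows v).map fun x c => ev x (rows.filter fun r => (fun a => r (v a)) = x) (e c)

/-- The selected rows have all grouping values, so opaque group keys and tuples of grouping values
determine each other through `Key.decode`. -/
theorem ColRel.fullOuterJoin_group {n j k : ℕ} (R : ColRel V n) (φ : Formula S n)
    (v : Fin j → Fin n) (e : Fin k → Item S n j) :
    (R.group φ v e).fullOuterJoin =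
      groupBy Item.columnarEval
        (R.fullOuterJoin.filter fun r =>
          Present (φ.attrs ∪ Finset.univ.image v) r ∧ φ.eval r = .t) v e := by
  set rows := R.fullOuterJoin.filter fun r =>
    Present (φ.attrs ∪ Finset.univ.image v) r ∧ φ.eval r = .t with hrows
  set ids : Finset (Key V) := if j = 0 then {Key.group []}
      else (R.expanded φ (Finset.univ.image v)).image (R.groupKey v) with hids
  have hdec : ∀ i ∈ R.expanded φ (Finset.univ.image v),
      (R.groupKey v i).decode j = fun a => R.entry i (v a) := by
    intro i hi
    simp only [ColRel.expanded, Finset.mem_filter] at hi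
    exact Key.decode_group_reduceOption
      (present_image.1 (present_union.1 (show Present _ (R.entry i) from hi.2.1)).2)
  have hkey : ∀ i ∈ R.expanded φ (Finset.univ.image v), ∀ g ∈ ids,
      (R.groupKey v i = g ↔ (fun a => R.entry i (v a)) = g.decode j) := by
    intro i hi g hg
    rw [← hdec i hi]
    refine ⟨fun h => h ▸ rfl, fun h => ?_⟩
    rw [hids] at hg
    split at hg
    -- With no grouping attribute, every row has the key `Key.group []`.
    · subst j
      rw [Finset.mem_singleton.1 hg]
      simp [ColRel.groupKey]
    · obtain ⟨i', hi', rfl⟩ := Finset.mem_image.1 hg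
      rw [hdec i hi, hdec i' hi'] at h
      exact congrArg (fun x => Key.group (List.ofFn x).reduceOption) h
  have hkeys : groupKeys rows v = ids.val.map (Key.decode j) := by
    rw [hids, groupKeys]
    split
    · subst j
      simp only [Finset.singleton_val, Multiset.map_singleton, Multiset.singleton_inj]
      exact Subsingleton.elim _ _
    · have hinj : Set.InjOn (Key.decode j)
          (↑((R.expanded φ (Finset.univ.image v)).image (R.groupKey v)) : Set (Key V)) := by
        intro g hg g' hg' h
        obtain ⟨i, hi, rfl⟩ := Finset.mem_image.1 hg
        obtain ⟨i', hi', rfl⟩ := Finset.mem_image.1 hg'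
        rw [hdec i hi, hdec i' hi'] at h
        exact congrArg (fun x => Key.group (List.ofFn x).reduceOption) h
      rw [← Finset.image_val_of_injOn hinj, Finset.image_image, Finset.image_val, hrows,
        ← R.map_expanded φ _ fun r a => r (v a)]
      exact congrArg _ (Multiset.map_congr rfl fun i hi => (hdec i hi).symm)
  rw [ColRel.group, ColRel.fullOuterJoin_ofEntries, groupBy, hkeys, Multiset.map_map]
  refine Multiset.map_congr rfl fun g hg => funext fun c => ?_
  obtain ⟨l, rfl⟩ : ∃ l, g = Key.group l := by
    rw [hids] at hg
    split at hg
    · exact ⟨[], Finset.mem_singleton.1 hg⟩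
    · obtain ⟨i, _, rfl⟩ := Finset.mem_image.1 hg
      exact ⟨_, rfl⟩
  simp only [Function.comp]
  cases e c with
  | key e => rfl
  | agg f e =>
    have hmap : ((R.expanded φ (Finset.univ.image v ∪ e.attrs)).filter
          fun i => R.groupKey v i = Key.group l).val.map (fun i => R.entry i) =
        (rows.filter fun r => (fun a => r (v a)) = (Key.group l).decode j).filter
          (Present e.attrs) := by
      rw [Multiset.filter_filter, hrows, Multiset.filter_filter, ColRel.fullOuterJoin,
        Multiset.filter_map, ColRel.expanded, Finset.filter_filter, Finset.filter_val]
      refine congrArg _ (Multiset.filter_congr fun i hi => ?_)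
      have hj : R.Joins (φ.attrs ∪ (Finset.univ.image v ∪ e.attrs)) i ↔
          Present (φ.attrs ∪ Finset.univ.image v) (R.entry i) ∧
            Present e.attrs (R.entry i) := by
        rw [← present_union, Finset.union_assoc]
        rfl
      rw [hj]
      simp only [Function.comp]
      constructor
      · rintro ⟨⟨⟨h₁, h₂⟩, h₃⟩, h₄⟩
        exact ⟨⟨h₂, (hkey i (Finset.mem_filter.2 ⟨hi, h₁, h₃⟩) _ hg).1 h₄⟩, h₁, h₃⟩
      · rintro ⟨⟨h₂, h₄⟩, h₁, h₃⟩
        exact ⟨⟨⟨h₁, h₂⟩, h₃⟩, (hkey i (Finset.mem_filter.2 ⟨hi, h₁, h₃⟩) _ hg).2 h₄⟩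
    simp only [Item.columnarEval, ← hmap, Multiset.map_map,
      Multiset.map_eq_zero, Finset.val_eq_zero]
    rfl

variable {D : Schema}

/-! ### Definable functions of the instance -/

variable (S) in
/-- The function `F` of the instance is computed by some query under Columnar Semantics. -/
def Definable {n : ℕ} (F : Instance V D → Multiset (Row V n)) : Prop :=
  ∃ q : Query S D n, ∀ I : Instance V D, (q.columnar I.normalize).fullOuterJoin = F I

namespace Definable

theorem table (t : D.Table) :
    Definable S fun I : Instance V D => (I t : Multiset (Row V (D.arity t))) :=
  ⟨.table t, fun I => fullOuterJoin_normalize (I t)⟩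

variable {m n k j : ℕ} {F G : Instance V D → Multiset (Row V n)}

theorem cross {F : Instance V D → Multiset (Row V m)} (hF : Definable S F) (hG : Definable S G) :
    Definable S fun I => (F I ×ˢ G I).map fun p => Fin.append p.1 p.2 := by
  obtain ⟨q, hq⟩ := hF
  obtain ⟨q', hq'⟩ := hG
  refine ⟨.cross q q', fun I => ?_⟩
  rw [Query.columnar, ColRel.fullOuterJoin_cross, hq, hq']

theorem add (hF : Definable S F) (hG : Definable S G) : Definable S fun I => F I + G I := by
  obtain ⟨q, hq⟩ := hF
  obtain ⟨q', hq'⟩ := hG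
  refine ⟨.union q q', fun I => ?_⟩
  rw [Query.columnar, ColRel.fullOuterJoin_union, hq, hq']

theorem inter (hF : Definable S F) (hG : Definable S G) : Definable S fun I => F I ∩ G I := by
  obtain ⟨q, hq⟩ := hF
  obtain ⟨q', hq'⟩ := hG
  refine ⟨.inter q q', fun I => ?_⟩
  rw [Query.columnar, fullOuterJoin_normalize, Multiset.coe_toList, hq, hq']

theorem sub (hF : Definable S F) (hG : Definable S G) : Definable S fun I => F I - G I := by
  obtain ⟨q, hq⟩ := hF
  obtain ⟨q', hq'⟩ := hG
  refine ⟨.except q q', fun I => ?_⟩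
  rw [Query.columnar, fullOuterJoin_normalize, Multiset.coe_toList, hq, hq']

theorem dedup (hF : Definable S F) : Definable S fun I => (F I).dedup := by
  obtain ⟨q, hq⟩ := hF
  refine ⟨.distinct q, fun I => ?_⟩
  rw [Query.columnar, fullOuterJoin_normalize, Multiset.coe_toList, hq]

theorem select_present (hF : Definable S F) (φ : Formula S n) (e : Fin k → Expr S n) :
    Definable S fun I => ((F I).filter fun r => Present φ.attrs r ∧ φ.eval r = .t).map
      fun r c => (e c).eval r := by
  obtain ⟨q, hq⟩ := hF
  refine ⟨.select q φ e, fun I => ?_⟩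
  rw [Query.columnar, ColRel.fullOuterJoin_select, hq]

theorem map (hF : Definable S F) (e : Fin k → Expr S n) :
    Definable S fun I => (F I).map fun r c => (e c).eval r := by
  simpa [Formula.attrs, Formula.eval, present_empty] using hF.select_present .tt e

theorem map_comp (hF : Definable S F) (f : Fin k → Fin n) :
    Definable S fun I => (F I).map fun r c => r (f c) :=
  hF.map fun c => .attr (f c)

/-- Every query starts from a table, so the empty bag is obtained by an unsatisfiable selection from
a given query. -/
theorem zero (hF : Definable S F) (k : ℕ) :
    Definable S fun _ : Instance V D => (0 : Multiset (Row V k)) := by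
  simpa [Formula.eval, Truth.not] using hF.select_present (.not .tt) fun _ : Fin k => .null

theorem sum {ι : Type*} (s : Finset ι) (hF : Definable S F)
    {G : ι → Instance V D → Multiset (Row V k)} (hG : ∀ i, Definable S (G i)) :
    Definable S fun I => ∑ i ∈ s, G i I := by
  classical
  induction s using Finset.induction_on with
  | empty => simpa using hF.zero k
  | insert i s hi ih => simpa [Finset.sum_insert hi] using (hG i).add ih

/-- On the rows with missing set `M`, the nullified formula has the same value as `φ` and mentions
only present attributes, so the columnar selection loses none of them. -/
theorem filter (hF : Definable S F) (φ : Formula S n) :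
    Definable S fun I => (F I).filter fun r => φ.eval r = .t := by
  have h (M : Finset (Fin n)) : Definable S fun I =>
      ((F I).filter fun r => φ.eval r = .t).filter fun r => missingSet r = M := by
    have := hF.select_present (.and (.mask id M) (φ.nullify M)) fun a => .attr a
    simp only [Expr.eval, Formula.attrs, Formula.attrs_mask, Finset.empty_union, Formula.eval,
      Truth.and_eq_t, Formula.eval_mask, id, Multiset.map_id'] at this
    convert this using 2 with I
    rw [Multiset.filter_filter]
    refine Multiset.filter_congr fun r _ => ?_
    constructor
    · rintro ⟨rfl, h⟩
      refine ⟨fun a ha => ?_, rfl, ?_⟩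
      · have := Finset.disjoint_left.1 (Formula.disjoint_attrs_nullify _ φ) ha
        rwa [mem_missingSet, ← ne_eq, ← Option.isSome_iff_ne_none] at this
      · rwa [Formula.eval_nullify fun a => mem_missingSet.1]
    · rintro ⟨_, rfl, h⟩
      rw [Formula.eval_nullify fun a => mem_missingSet.1] at h
      exact ⟨rfl, h⟩
  simpa only [Multiset.sum_filter_eq] using hF.sum Finset.univ h

/-- Removing duplicates from `K` gives each row at most one partner in the cross product, so
multiplicities are preserved. -/
theorem semijoin {K : Instance V D → Multiset (Row V j)} (hF : Definable S F)
    (hK : Definable S K) (w : Fin j → Fin n) :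
    Definable S fun I => (F I).filter fun r => (fun a => r (w a)) ∈ K I := by
  have := ((hF.cross hK.dedup).filter (.all fun a =>
    .same (Fin.castAdd j (w a)) (Fin.natAdd n a))).map_comp (Fin.castAdd j)
  convert this using 2 with I
  simp only [Formula.eval_all, Formula.eval_same, Multiset.filter_map, Multiset.map_map,
    Function.comp_def, Fin.append_left, Fin.append_right]
  induction F I using Multiset.induction_on with
  | empty => simp
  | cons r s ih =>
    simp only [Multiset.cons_product, Multiset.filter_add, Multiset.map_add, ← ih,
      Multiset.filter_cons, Multiset.filter_map, Multiset.map_map, Function.comp_def]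
    congr 1
    have (x : Row V j) : (∀ a, r (w a) = x a) ↔ x = fun a => r (w a) := by
      rw [funext_iff]
      simp only [eq_comm]
    simp only [this, Multiset.filter_eq', Multiset.map_replicate]
    by_cases h : (fun a => r (w a)) ∈ K I
    · rw [if_pos h, Multiset.count_eq_one_of_mem (Multiset.nodup_dedup _)
        (Multiset.mem_dedup.2 h), Multiset.replicate_one]
    · rw [if_neg h, Multiset.count_eq_zero_of_notMem (by simpa using h), Multiset.replicate_zero]

/-- The semijoin keeps all copies of a row or none, so the bag difference is exactly its complement.
-/
theorem antijoin {K : Instance V D → Multiset (Row V j)} (hF : Definable S F)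
    (hK : Definable S K) (w : Fin j → Fin n) :
    Definable S fun I => (F I).filter fun r => (fun a => r (w a)) ∉ K I := by
  convert hF.sub (hF.semijoin hK w) using 2 with I
  conv_rhs => enter [1]; rw [← Multiset.filter_add_not (fun r => (fun a => r (w a)) ∈ K I) (F I)]
  rw [add_tsub_cancel_left]

/-- In the rows whose columns `w` are in `K`, column `c` becomes null. -/
theorem erase {K : Instance V D → Multiset (Row V j)} (hF : Definable S F)
    (hK : Definable S K) (w : Fin j → Fin n) (c : Fin n) :
    Definable S fun I => (F I).map fun r b =>
      if b = c ∧ (fun a => r (w a)) ∈ K I then none else r b := by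
  convert ((hF.semijoin hK w).map fun b => if b = c then .null else .attr b).add
    (hF.antijoin hK w) using 2 with I
  conv_lhs => rw [← Multiset.filter_add_not (fun r => (fun a => r (w a)) ∈ K I) (F I)]
  rw [Multiset.map_add]
  congr 1
  · refine Multiset.map_congr rfl fun r hr => funext fun b => ?_
    by_cases hb : b = c <;> simp [hb, (Multiset.mem_filter.1 hr).2, Expr.eval]
  · conv_rhs => rw [← Multiset.map_id ((F I).filter _)]
    refine Multiset.map_congr rfl fun r hr => funext fun b => ?_
    simp [(Multiset.mem_filter.1 hr).2]

/-- In the rows whose columns `w` are in `K b`, column `b` becomes null. -/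
theorem erase_all {K : Fin n → Instance V D → Multiset (Row V j)} (hF : Definable S F)
    (hK : ∀ b, Definable S (K b)) (w : Fin j → Fin n) (hw : ∀ a I, K (w a) I = 0) :
    Definable S fun I => (F I).map fun r b =>
      if (fun a => r (w a)) ∈ K b I then none else r b := by
  suffices h : ∀ s : Finset (Fin n), Definable S fun I => (F I).map fun r b =>
      if b ∈ s ∧ (fun a => r (w a)) ∈ K b I then none else r b by
    simpa using h Finset.univ
  intro s
  induction s using Finset.induction_on with
  | empty => simpa using hF
  | insert c s hc ih =>
    convert ih.erase (hK c) w c using 2 with I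
    rw [Multiset.map_map]
    refine Multiset.map_congr rfl fun r _ => funext fun b => ?_
    -- The columns `w` are never erased, as their `K` is empty. The test for column `c` therefore
    -- still reads the original values.
    simp only [Function.comp, hw, Multiset.notMem_zero, and_false, if_false, Finset.mem_insert]
    by_cases hb : b = c
    · subst hb
      simp [hc]
    · simp [hb]

end Definable

/-! ### Grouping -/

/-- By strictness every row of the group has all attributes of `e`, so the columnar aggregate skips
none. -/
theorem Item.columnarEval_eq_eval {n j : ℕ} {x : Row V j} {g : Multiset (Row V n)}
    {f : S.Agg} {e : Expr S n} (hg : ∀ r ∈ g, e.eval r ≠ none) (h0 : j ≠ 0 → g ≠ 0) :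
    (Item.agg f e : Item S n j).columnarEval x g = (Item.agg f e : Item S n j).eval x g := by
  have : g.filter (Present e.attrs) = g :=
    Multiset.filter_eq_self.2 fun r hr => Expr.present_of_eval_ne_none (hg r hr)
  simp only [Item.columnarEval, Item.eval, this]
  exact if_neg fun h => h0 h.2 h.1

theorem filter_ne_zero_of_mem_groupKeys {n j : ℕ} {rows : Multiset (Row V n)} {v : Fin j → Fin n}
    {x : Row V j} (hx : x ∈ groupKeys rows v) (hj : j ≠ 0) :
    (rows.filter fun r => (fun a => r (v a)) = x) ≠ 0 := by
  simp only [groupKeys, if_neg hj, Multiset.mem_dedup, Multiset.mem_map] at hx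
  obtain ⟨r, hr, rfl⟩ := hx
  exact fun h => Multiset.notMem_zero r (h ▸ Multiset.mem_filter.2 ⟨hr, rfl⟩)

/-- The rows on which the argument of an aggregate is null. -/
def Item.nullArgument {n j : ℕ} : Item S n j → Formula S n
  | .key _ => .not .tt
  | .agg _ e => .isNull e

/-- Erasing the entry in groups with a null argument corrects the columnar aggregate: there the
standard value is null, and elsewhere the two agree. -/
theorem Item.eval_eq_ite {n j : ℕ} {rows : Multiset (Row V n)} {v : Fin j → Fin n}
    {x : Row V j} (hx : x ∈ groupKeys rows v) (e : Item S n j) :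
    (if x ∈ (rows.filter fun r => e.nullArgument.eval r = .t).map fun r a => r (v a) then none
      else e.columnarEval x (rows.filter fun r => (fun a => r (v a)) = x)) =
      e.eval x (rows.filter fun r => (fun a => r (v a)) = x) := by
  cases e with
  | key e => simp [Item.nullArgument, Formula.eval, Truth.not, Item.columnarEval, Item.eval]
  | agg f e =>
    have hiff : x ∈ (rows.filter fun r => (Item.agg f e : Item S n j).nullArgument.eval r = .t).map
        (fun r a => r (v a)) ↔ ∃ r, (r ∈ rows ∧ e.eval r = none) ∧ (fun a => r (v a)) = x := by
      simp [Item.nullArgument, Formula.eval, Truth.ofBool_eq_t]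
    by_cases h : ∃ r, (r ∈ rows ∧ e.eval r = none) ∧ (fun a => r (v a)) = x
    · rw [if_pos (hiff.2 h)]
      obtain ⟨r, ⟨hr, hn⟩, rfl⟩ := h
      rw [Item.eval, aggregate, if_pos]
      exact Multiset.mem_map.2 ⟨r, Multiset.mem_filter.2 ⟨hr, rfl⟩, hn⟩
    · rw [if_neg (mt hiff.1 h)]
      refine Item.columnarEval_eq_eval (fun r hr hn => h ?_) (filter_ne_zero_of_mem_groupKeys hx)
      rw [Multiset.mem_filter] at hr
      exact ⟨r, ⟨hr.1, hn⟩, hr.2⟩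

namespace Definable

variable {n j k : ℕ} {F : Instance V D → Multiset (Row V n)}

theorem groupBy_columnarEval (hF : Definable S F) (v : Fin j → Fin n) (e : Fin k → Item S n j)
    (hv : ∀ I, ∀ r ∈ F I, ∀ a, (r (v a)).isSome) :
    Definable S fun I => groupBy Item.columnarEval (F I) v e := by
  obtain ⟨q, hq⟩ := hF
  refine ⟨.group q .tt v e, fun I => ?_⟩
  rw [Query.columnar, ColRel.fullOuterJoin_group, hq]
  congr 1
  refine Multiset.filter_eq_self.2 fun r hr => ⟨present_union.2 ⟨present_empty r, ?_⟩, rfl⟩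
  exact present_image.2 (hv I r hr)

theorem groupBy_of_isSome (hF : Definable S F) (v : Fin j → Fin n) (e : Fin k → Item S n j)
    (hv : ∀ I, ∀ r ∈ F I, ∀ a, (r (v a)).isSome) :
    Definable S fun I => groupBy Item.eval (F I) v e := by
  -- The grouping values are output as extra columns, so that the erasure can identify the groups;
  -- they are projected away afterwards.
  let e' : Fin (k + j) → Item S n j := Fin.append e fun a => .key (.attr a)
  have hK (b : Fin (k + j)) := (hF.filter (e' b).nullArgument).map_comp v
  have := ((hF.groupBy_columnarEval v e' hv).erase_all hK (Fin.natAdd k) fun a I => by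
    simp [e', Item.nullArgument, Formula.eval, Truth.not]).map_comp (Fin.castAdd j)
  convert this using 2 with I
  simp only [groupBy, Multiset.map_map, Function.comp_def]
  refine Multiset.map_congr rfl fun x hx => funext fun c => ?_
  have h₁ : e' (Fin.castAdd j c) = e c := Fin.append_left ..
  have h₂ (a : Fin j) : e' (Fin.natAdd k a) = .key (.attr a) := Fin.append_right ..
  rw [← Item.eval_eq_ite hx]
  simp only [h₁, h₂]
  rfl

end Definable

/-- The row with `d` in the columns `M`. -/
def fill {j : ℕ} (d : V) (M : Finset (Fin j)) (x : Row V j) : Row V j :=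
  fun a => if a ∈ M then some d else x a

omit [DecidableEq V] in
-- A filled-in `d` may coincide with a genuine `d`, but not when the two rows have the same missing
-- columns.
theorem fill_inj {j : ℕ} {d : V} {x y : Row V j} (h : missingSet x = missingSet y)
    (hxy : fill d (missingSet x) x = fill d (missingSet x) y) : x = y := by
  ext1 a
  by_cases ha : a ∈ missingSet x
  · rw [mem_missingSet.1 ha, (mem_missingSet.1 (h ▸ ha) : y a = none)]
  · simpa [fill, ha] using congrFun hxy a

/-- The item for groups in which the grouping values `M` are null but have been filled, the
grouping values being stored in additional columns. -/
def Item.unfill {n j : ℕ} (M : Finset (Fin j)) : Item S n j → Item S (n + j) j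
  | .key e => .key (e.nullify M)
  | .agg f e => .agg f (e.subst fun a => .attr (Fin.castAdd j a))

/-- For a fixed pattern `M`, filling is injective on grouping values, so the groups stay the same.
Aggregates read the original columns, kept to the left of the filled ones. -/
theorem groupBy_fill {n j k : ℕ} (hj : j ≠ 0) (d : V) (M : Finset (Fin j))
    (rows : Multiset (Row V n)) (v : Fin j → Fin n) (e : Fin k → Item S n j) :
    groupBy Item.eval
        ((rows.filter fun r => missingSet (fun a => r (v a)) = M).map fun r =>
          Fin.append r (fill d M fun a => r (v a)))
        (Fin.natAdd n) (fun c => (e c).unfill M) =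
      ((groupKeys rows v).filter fun x => missingSet x = M).map fun x c =>
        (e c).eval x (rows.filter fun r => (fun a => r (v a)) = x) := by
  have hkeys : groupKeys ((rows.filter fun r => missingSet (fun a => r (v a)) = M).map fun r =>
        Fin.append r (fill d M fun a => r (v a))) (Fin.natAdd n) =
      ((groupKeys rows v).filter fun x => missingSet x = M).map (fill d M) := by
    simp only [groupKeys, if_neg hj, Multiset.map_map, Function.comp_def, Fin.append_right]
    rw [← Multiset.dedup_filter, ← Multiset.dedup_map_of_injOn, Multiset.filter_map,
      Multiset.map_map]
    · rfl
    · intro x hx y hy h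
      obtain rfl := (Multiset.mem_filter.1 hx).2
      exact fill_inj (Multiset.mem_filter.1 hy).2.symm h
  rw [groupBy, hkeys, Multiset.map_map]
  refine Multiset.map_congr rfl fun x hx => funext fun c => ?_
  obtain rfl := (Multiset.mem_filter.1 hx).2
  simp only [Function.comp_def]
  cases e c with
  | key e =>
    simp only [Item.unfill, Item.eval, Expr.eval_nullify]
    congr 1
    ext1 a
    by_cases ha : a ∈ missingSet x
    · rw [if_pos ha, mem_missingSet.1 ha]
    · simp [fill, ha]
  | agg f e =>
    simp only [Item.unfill, Item.eval, Multiset.filter_map, Multiset.map_map, Function.comp_def,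
      Expr.eval_subst, Expr.eval, Fin.append_left, Fin.append_right, Multiset.filter_filter]
    congr 2
    refine Multiset.filter_congr fun r _ => ⟨fun h => (fill_inj h.2.symm h.1.symm).symm, ?_⟩
    rintro rfl
    exact ⟨rfl, rfl⟩

theorem Definable.groupBy [Nonempty V] {n j k : ℕ} {F : Instance V D → Multiset (Row V n)}
    (hF : Definable S F) (v : Fin j → Fin n) (e : Fin k → Item S n j) :
    Definable S fun I => groupBy Item.eval (F I) v e := by
  by_cases hj : j = 0
  · subst hj
    exact hF.groupBy_of_isSome v e fun _ _ _ a => a.elim0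
  -- Any value serves: by `groupBy_fill` the result does not depend on `d`.
  have d : V := Classical.arbitrary V
  have h (M : Finset (Fin j)) : Definable S fun I =>
      ((groupKeys (F I) v).filter fun x => missingSet x = M).map fun x c =>
        (e c).eval x ((F I).filter fun r => (fun a => r (v a)) = x) := by
    simp only [← groupBy_fill hj d M]
    refine Definable.groupBy_of_isSome ?_ _ _ ?_
    · convert (hF.filter (.mask v M)).map
        (Fin.append .attr fun a => if a ∈ M then .const d else .attr (v a)) using 2 with I
      simp only [Formula.eval_mask]
      refine Multiset.map_congr rfl fun r _ => funext fun b => ?_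
      refine Fin.addCases (fun b => ?_) (fun b => ?_) b
      · simp [Expr.eval]
      · by_cases hb : b ∈ M <;> simp [fill, hb, Expr.eval]
    · intro I r hr a
      simp only [Multiset.mem_map, Multiset.mem_filter] at hr
      obtain ⟨r, ⟨_, rfl⟩, rfl⟩ := hr
      rw [Fin.append_right, fill]
      split <;> rename_i ha
      · rfl
      · rwa [mem_missingSet, ← ne_eq, ← Option.isSome_iff_ne_none] at ha
  -- Each group key has exactly one pattern of nulls, so the pieces partition the groups.
  have hsum := hF.sum Finset.univ h
  simp only [← Multiset.coe_mapAddMonoidHom, ← map_sum, Multiset.sum_filter_eq] at hsum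
  exact hsum

theorem Query.eval_group {n j k : ℕ} (I : Instance V D) (q : Query S D n) (φ : Formula S n)
    (v : Fin j → Fin n) (e : Fin k → Item S n j) :
    (Query.group q φ v e).eval I =
      groupBy Item.eval ((q.eval I).filter fun r => φ.eval r = .t) v e :=
  rfl

theorem Query.definable_eval [Nonempty V] {n : ℕ} (q : Query S D n) :
    Definable S fun I => q.eval I := by
  induction q with
  | table t => exact .table t
  | cross q₁ q₂ h₁ h₂ => exact h₁.cross h₂
  | select q φ e h => exact (h.filter φ).map e
  | group q φ v e h => exact (h.filter φ).groupBy v e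
  | union q₁ q₂ h₁ h₂ => exact h₁.add h₂
  | inter q₁ q₂ h₁ h₂ => exact h₁.inter h₂
  | except q₁ q₂ h₁ h₂ => exact h₁.sub h₂
  | distinct q h => exact h.dedup

/-! ### Null-free queries -/

theorem aggregate_ne_none {f : S.Agg} {b : Multiset (Option V)} (hb : none ∉ b)
    (h0 : b = 0 → (S.aggEmpty f).isSome) : aggregate S f b ≠ none := by
  rw [aggregate, if_neg hb]
  split <;> rename_i h
  · exact Option.isSome_iff_ne_none.1 (h0 h)
  · exact Option.some_ne_none _

theorem ne_none_of_mem_groupKeys {n j : ℕ} {rows : Multiset (Row V n)} {v : Fin j → Fin n}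
    (hrows : ∀ r ∈ rows, ∀ a, r a ≠ none) {x : Row V j} (hx : x ∈ groupKeys rows v) (a : Fin j) :
    x a ≠ none := by
  have hj : j ≠ 0 := fun h => (h ▸ a).elim0
  simp only [groupKeys, if_neg hj, Multiset.mem_dedup, Multiset.mem_map] at hx
  obtain ⟨r, hr, rfl⟩ := hx
  exact hrows r hr (v a)

theorem Query.NullFree.eval_ne_none {n : ℕ} {q : Query S D n} (hq : q.NullFree)
    {I : Instance V D} (hI : I.NullFree) : ∀ r ∈ q.eval I, ∀ a, r a ≠ none := by
  induction q with
  | table t => exact hI t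
  | cross q₁ q₂ h₁ h₂ =>
    intro r hr
    obtain ⟨⟨r₁, r₂⟩, hp, rfl⟩ := Multiset.mem_map.1 hr
    obtain ⟨hr₁, hr₂⟩ := Multiset.mem_product.1 hp
    refine Fin.addCases (fun a => ?_) (fun a => ?_)
    · simpa using h₁ hq.1 _ hr₁ a
    · simpa using h₂ hq.2 _ hr₂ a
  | select q φ e h =>
    intro r hr c
    obtain ⟨r', hr', rfl⟩ := Multiset.mem_map.1 hr
    exact (hq.2.2 c).eval_ne_none (h hq.1 _ (Multiset.mem_filter.1 hr').1)
  | group q φ v e h =>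
    intro r hr c
    obtain ⟨x, hx, rfl⟩ := Multiset.mem_map.1 (Query.eval_group I q φ v e ▸ hr)
    have hrows : ∀ r ∈ (q.eval I).filter fun r => φ.eval r = .t, ∀ a, r a ≠ none :=
      fun r hr => h hq.1 r (Multiset.mem_filter.1 hr).1
    have he := hq.2.2 c
    revert he
    beta_reduce
    cases e c with
    | key e => exact fun he => Expr.NullFree.eval_ne_none he (ne_none_of_mem_groupKeys hrows hx)
    | agg f e =>
      intro he
      refine aggregate_ne_none (fun hn => ?_) fun h0 => he.2 ?_
      · obtain ⟨r, hr, hn⟩ := Multiset.mem_map.1 hn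
        exact he.1.eval_ne_none (hrows r (Multiset.mem_filter.1 hr).1) hn
      -- With `GROUP BY` no group is empty, so the value on the empty bag matters only for `j = 0`.
      · by_contra hj
        exact filter_ne_zero_of_mem_groupKeys hx hj (Multiset.map_eq_zero.1 h0)
  | union q₁ q₂ h₁ h₂ =>
    intro r hr
    exact (Multiset.mem_add.1 hr).elim (h₁ hq.1 r) (h₂ hq.2 r)
  | inter q₁ q₂ h₁ h₂ => exact fun r hr => h₁ hq.1 r (Multiset.mem_inter.1 hr).1
  | except q₁ q₂ h₁ h₂ =>
    exact fun r hr => h₁ hq.1 r (Multiset.mem_of_le (Multiset.sub_le_self _ _) hr)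
  | distinct q h => exact fun r hr => h hq r (Multiset.mem_dedup.1 hr)

theorem groupBy_columnarEval_eq {n j k : ℕ} {rows : Multiset (Row V n)} {v : Fin j → Fin n}
    {e : Fin k → Item S n j} (hrows : ∀ r ∈ rows, ∀ a, r a ≠ none) (he : ∀ c, (e c).NullFree) :
    groupBy Item.columnarEval rows v e = groupBy Item.eval rows v e := by
  refine Multiset.map_congr rfl fun x hx => funext fun c => ?_
  have hc := he c
  revert hc
  cases e c with
  | key e => exact fun _ => rfl
  | agg f e =>
    intro hc
    exact Item.columnarEval_eq_eval
      (fun r hr => hc.1.eval_ne_none (hrows r (Multiset.mem_filter.1 hr).1))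
      (filter_ne_zero_of_mem_groupKeys hx)

/-- On null-free rows the columnar demand for entries is vacuous. -/
theorem filter_present_and {n : ℕ} {rows : Multiset (Row V n)}
    (hrows : ∀ r ∈ rows, ∀ a, r a ≠ none) (φ : Formula S n) (A : Finset (Fin n)) :
    (rows.filter fun r => Present A r ∧ φ.eval r = .t) = rows.filter fun r => φ.eval r = .t :=
  Multiset.filter_congr fun r hr =>
    and_iff_right fun a _ => Option.isSome_iff_ne_none.2 (hrows r hr a)

theorem Query.NullFree.fullOuterJoin_columnar {n : ℕ} {q : Query S D n} (hq : q.NullFree)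
    {I : Instance V D} (hI : I.NullFree) :
    (q.columnar I.normalize).fullOuterJoin = q.eval I := by
  induction q with
  | table t => exact fullOuterJoin_normalize (I t)
  | cross q₁ q₂ h₁ h₂ =>
    rw [Query.columnar, ColRel.fullOuterJoin_cross, h₁ hq.1, h₂ hq.2, Query.eval]
  | select q φ e h =>
    rw [Query.columnar, ColRel.fullOuterJoin_select, h hq.1,
      filter_present_and (hq.1.eval_ne_none hI), Query.eval]
  | group q φ v e h =>
    rw [Query.columnar, ColRel.fullOuterJoin_group, h hq.1,
      filter_present_and (hq.1.eval_ne_none hI), Query.eval_group]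
    exact groupBy_columnarEval_eq
      (fun r hr => hq.1.eval_ne_none hI r (Multiset.mem_filter.1 hr).1) hq.2.2
  | union q₁ q₂ h₁ h₂ =>
    rw [Query.columnar, ColRel.fullOuterJoin_union, h₁ hq.1, h₂ hq.2, Query.eval]
  | inter q₁ q₂ h₁ h₂ =>
    rw [Query.columnar, fullOuterJoin_normalize, Multiset.coe_toList, h₁ hq.1, h₂ hq.2, Query.eval]
  | except q₁ q₂ h₁ h₂ =>
    rw [Query.columnar, fullOuterJoin_normalize, Multiset.coe_toList, h₁ hq.1, h₂ hq.2, Query.eval]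
  | distinct q h =>
    rw [Query.columnar, fullOuterJoin_normalize, Multiset.coe_toList, h hq, Query.eval]

end ColumnarSQL

theorem proposition1 {V : Type*} [DecidableEq V] [Nonempty V]
    (S : ColumnarSQL.Vocabulary V) (D : ColumnarSQL.Schema) {n : ℕ}
    (Q3vl : ColumnarSQL.Query S D n) (hQ : Q3vl.IsSQL) :
    (∃ Qcs : ColumnarSQL.Query S D n, ∀ I : ColumnarSQL.Instance V D,
      (Qcs.columnar I.normalize).fullOuterJoin = Q3vl.eval I) ∧
    (Q3vl.NullFree → ∀ I : ColumnarSQL.Instance V D, I.NullFree →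
      (Q3vl.columnar I.normalize).fullOuterJoin = Q3vl.eval I) :=
  ⟨Q3vl.definable_eval, fun h _ hI => h.fullOuterJoin_columnar hI⟩
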